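/- Let $p$ be an odd prime, let $m\ge 1$, and let $\theta$ be the automorphism $\theta(a)=a^{p^l}$ of $\mathbb F_{p^m}$, where $l\ge 1$. Put $e=\gcd(l,m)$ and $f=m/e$, so that the fixed field of $\theta$ is $\mathbb F_{p^e}$ and $\theta$ has order $f$. Let $G=A_p(m,\theta)$ be the Suzuki $p$-group of type $A$, that is, the set $\mathbb F_{p^m}\times\mathbb F_{p^m}$ with multiplication $(a,b)(c,d)=(a+c,\,b+d+a\theta(c))$. Suppose that $f>1$, that $m$ and $f$ are odd, and that $p\nmid f$. For $b\in\mathbb F_{p^m}$ put $C_b=\{(0,b)\}$, and for $a\in\mathbb F_{p^m}^*$ and $x\in\mathbb F_{p^e}$ put $$C_{a,x}=\{(a,\;a\theta(a)x+a\theta(y)-y\theta(a)) : y\in\mathbb F_{p^m}\}.$$ Let $\mathrm{Tr}_e$ be the absolute trace $\mathbb F_{p^e}\to\mathbb F_p$, let $z$ be a nonzero square in $\mathbb F_{p^e}$ with $\mathrm{Tr}_e(z)=0$, let $\phi_z(y)=\exp\!\big(\tfrac{2\pi i}{p}\mathrm{Tr}_e(zy)\big)$ for $y\in\mathbb F_{p^e}$,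 and let $\operatorname{Ker}\phi_z=\{y\in\mathbb F_{p^e}:\phi_z(y)=1\}$. Set $$D_z=\bigcup_{a\in\mathbb F_{p^m}^*,\;x\in\operatorname{Ker}\phi_z}C_{a,x},\qquad D_z'=D_z\cup\bigcup_{b\in\mathbb F_{p^m}^*}C_b .$$ A subset $D$ of a finite group $G$ is a $(v,k,\lambda,\mu)$-partial difference set if $|G|=v$, $|D|=k$, and the differences $d_1d_2^{-1}$ with $d_1,d_2\in D$, $d_1\ne d_2$, represent each non-identity element of $D$ exactly $\lambda$ times and each non-identity element of $G\setminus D$ exactly $\mu$ times. It is regular if $1_G\notin D$ and $D^{-1}=D$, central if $D$ is a union of conjugacy classes of $G$, and of Latin square type if $(v,k,\lambda,\mu)=(n^2,\,r(n-1),\,r^2+n-3r,\,r^2-r)$ for some $n,r$. Then $D_z$ is a regular Latin square type central partial difference set in $G$ with parameters $$\big(p^{2m},\;p^{m-1}(p^m-1),\;p^{2(m-1)}+p^m-3p^{m-1},\;p^{2(m-1)}-p^{m-1}\big),$$ and $D_z'$ is a regular Latin square type central partial difference set in $G$ with parameters $$\big(p^{2m},\;(p^{m-1}+1)(p^m-1),\;p^{2(m-1)}+p^m-p^{m-1}-2,\;p^{2(m-1)}+p^{m-1}\big).$$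 -/

import Mathlib

/-- `D` is a `(v, k, lam, mu)`-partial difference set in the group `G`: `G` is finite of order `v`,
`D` has `k` elements, and the differences `d₁ * d₂⁻¹` with `d₁, d₂ ∈ D`, `d₁ ≠ d₂`, represent every
non-identity element of `D` exactly `lam` times and every non-identity element outside `D`
exactly `mu` times. -/
structure IsPDS {G : Type*} [Group G] (D : Set G) (v k lam mu : ℤ) : Prop where
  finite : Finite G
  order : (Nat.card G : ℤ) = v
  size : (D.ncard : ℤ) = k
  count_mem : ∀ g : G, g ≠ 1 → g ∈ D →
    (({q : G × G | q.1 ∈ D ∧ q.2 ∈ D ∧ q.1 ≠ q.2 ∧ q.1 * q.2⁻¹ = g}.ncard : ℕ) : ℤ) = lam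
  count_not_mem : ∀ g : G, g ≠ 1 → g ∉ D →
    (({q : G × G | q.1 ∈ D ∧ q.2 ∈ D ∧ q.1 ≠ q.2 ∧ q.1 * q.2⁻¹ = g}.ncard : ℕ) : ℤ) = mu

/-- `D` does not contain the identity and is closed under inversion. -/
def IsRegularSubset {G : Type*} [Group G] (D : Set G) : Prop :=
  (1 : G) ∉ D ∧ ∀ g : G, g⁻¹ ∈ D ↔ g ∈ D

/-- `D` is a union of conjugacy classes of `G`. -/
def IsCentralSubset {G : Type*} [Group G] (D : Set G) : Prop :=
  ∃ S : Set (ConjClasses G), D = ⋃ C ∈ S, C.carrier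

/-- The parameters are `(n², r(n - 1), r² + n - 3r, r² - r)` for some `n` and `r`. -/
def IsLatinSquareType (v k lam mu : ℤ) : Prop :=
  ∃ n r : ℕ, v = (n : ℤ) ^ 2 ∧ k = (r : ℤ) * ((n : ℤ) - 1) ∧
    lam = (r : ℤ) ^ 2 + ((n : ℤ) - 3 * (r : ℤ)) ∧ mu = (r : ℤ) ^ 2 - (r : ℤ)

/-- `D` is a regular Latin square type central partial difference set with the given parameters. -/
structure IsLatinSquareCentralPDS {G : Type*} [Group G] (D : Set G) (v k lam mu : ℤ) : Prop where
  pds : IsPDS D v k lam mu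
  regular : IsRegularSubset D
  central : IsCentralSubset D
  latin : IsLatinSquareType v k lam mu

/-- The Suzuki `p`-group of type `A` attached to an automorphism `θ` of a field `K` of
characteristic `p` (every field automorphism of `K` fixes the prime field `ZMod p`): the set
`K × K` with multiplication `(a, b)(c, d) = (a + c, b + d + a θ(c))`. -/
@[ext]
structure SuzukiGroup {p : ℕ} [Fact p.Prime] {K : Type*} [Field K] [Algebra (ZMod p) K]
    (θ : K ≃ₐ[ZMod p] K) where
  fst : K
  snd : K

namespace SuzukiGroup

variable {p : ℕ} [Fact p.Prime] {K : Type*} [Field K] [Algebra (ZMod p) K]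

instance (θ : K ≃ₐ[ZMod p] K) : Mul (SuzukiGroup θ) :=
  ⟨fun g h => ⟨g.fst + h.fst, g.snd + h.snd + g.fst * θ h.fst⟩⟩

instance (θ : K ≃ₐ[ZMod p] K) : One (SuzukiGroup θ) := ⟨⟨0, 0⟩⟩

instance (θ : K ≃ₐ[ZMod p] K) : Inv (SuzukiGroup θ) :=
  ⟨fun g => ⟨-g.fst, -g.snd + g.fst * θ g.fst⟩⟩

@[simp] theorem fst_mul {θ : K ≃ₐ[ZMod p] K} (g h : SuzukiGroup θ) :
    (g * h).fst = g.fst + h.fst := rfl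

@[simp] theorem snd_mul {θ : K ≃ₐ[ZMod p] K} (g h : SuzukiGroup θ) :
    (g * h).snd = g.snd + h.snd + g.fst * θ h.fst := rfl

@[simp] theorem fst_one {θ : K ≃ₐ[ZMod p] K} : (1 : SuzukiGroup θ).fst = 0 := rfl

@[simp] theorem snd_one {θ : K ≃ₐ[ZMod p] K} : (1 : SuzukiGroup θ).snd = 0 := rfl

@[simp] theorem fst_inv {θ : K ≃ₐ[ZMod p] K} (g : SuzukiGroup θ) : (g⁻¹).fst = -g.fst := rfl

@[simp] theorem snd_inv {θ : K ≃ₐ[ZMod p] K} (g : SuzukiGroup θ) :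
    (g⁻¹).snd = -g.snd + g.fst * θ g.fst := rfl

instance (θ : K ≃ₐ[ZMod p] K) : Group (SuzukiGroup θ) :=
  Group.ofLeftAxioms
    (by intro x y z; ext <;> simp <;> ring)
    (by intro x; ext <;> simp)
    (by intro x; ext <;> simp)

/-- The subfield of elements fixed by `θ`. -/
abbrev fixedField (θ : K ≃ₐ[ZMod p] K) : IntermediateField (ZMod p) K :=
  IntermediateField.fixedField (Subgroup.zpowers θ)

/-- The additive map `x ↦ a θ(x) - x θ(a)`. -/
def commMap (θ : K ≃ₐ[ZMod p] K) (a : K) : K → K := fun x => a * θ x - x * θ a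

/-- The character `y ↦ ξ ^ Tr(w y)` of the fixed field of `θ`, where `ξ = exp (2πi / p)` and `Tr`
is the absolute trace of the fixed field. -/
noncomputable def phi (θ : K ≃ₐ[ZMod p] K) (w : fixedField θ) : fixedField θ → ℂ :=
  fun y => ZMod.stdAddChar (Algebra.trace (ZMod p) (fixedField θ) (w * y))

/-- The kernel of the character `phi θ w`. -/
def kerPhi (θ : K ≃ₐ[ZMod p] K) (w : fixedField θ) : Set (fixedField θ) :=
  {y | phi θ w y = 1}

/-- The class `C_b = {(0, b)}`. -/
def centralClass (θ : K ≃ₐ[ZMod p] K) (b : K) : Set (SuzukiGroup θ) := {⟨0, b⟩}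

/-- The class `C_{a,x} = {(a, a θ(a) x + y) : y ∈ Im (commMap θ a)}`. -/
def nonCentralClass (θ : K ≃ₐ[ZMod p] K) (a : K) (x : fixedField θ) : Set (SuzukiGroup θ) :=
  {g | ∃ y ∈ Set.range (commMap θ a), g = ⟨a, a * θ a * (x : K) + y⟩}

/-- The union of the `C_{a,x}` over `a ≠ 0` and `x` in the kernel of `phi θ z`. -/
def D (θ : K ≃ₐ[ZMod p] K) (z : fixedField θ) : Set (SuzukiGroup θ) :=
  ⋃ a ∈ {a : K | a ≠ 0}, ⋃ x ∈ kerPhi θ z, nonCentralClass θ a x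

/-- The union of `D θ z` and of the `C_b` over `b ≠ 0`. -/
def D' (θ : K ≃ₐ[ZMod p] K) (z : fixedField θ) : Set (SuzukiGroup θ) :=
  (⋃ b ∈ {b : K | b ≠ 0}, centralClass θ b) ∪ D θ z

end SuzukiGroup

/-! Write Tr for the absolute trace of `K`. Since `p` does not divide the order of `θ`, every
element of `K` is a fixed element plus some `θ y - y`, and Tr restricted to the fixed field is a
unit times its own trace. Hence `(a, b)` lies in `D θ z` iff `a ≠ 0` and Tr(z b / (a θ(a))) = 0
(`mem_D_iff`): over each `a ≠ 0` the set is a hyperplane of `K`.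

For `g = (c, d)`, the `h ∈ D` with `g * h ∈ D` are counted slice by slice over the first coordinate
`a` of `h`. A slice is cut out by two affine conditions, with coefficients z/(aθ(a)) and
z/((c+a)θ(c+a)).

If `c ≠ 0`, the coefficients are proportional over the prime field only when `t = a/(c+a)` has `t
θ(t)` in it; as `θ` has odd order and `m` is odd, this forces `t`, hence `a/c`, into the prime
field. The p^m - p values of `a` off the line of `c` give p^(m-2) each. On the line, Tr(z) = 0 makes
both conditions parallel: each of the p - 2 admissible points gives p^(m-1) if `g ∈ D`, and 0
otherwise.

If `c = 0`, both coefficients agree, and what is needed is the number of zeros of the quadratic form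
Tr(w a θ(a)) (`ncard_trace_mul_apply_eq_zero`). For `D'` only the slices `a = 0` and `a = -c`
change. -/

/-! ### Counting -/

/-- The number of solutions of a condition on a product, summed over the first coordinate. -/
theorem ncard_prod_eq_sum {α β : Type*} [Fintype α] [Finite β] (R : α → β → Prop) :
    {q : α × β | R q.1 q.2}.ncard = ∑ a, {b | R a b}.ncard := by
  have e : {q : α × β | R q.1 q.2} ≃ Σ a, {b | R a b} :=
    { toFun := fun q => ⟨q.1.1, q.1.2, q.2⟩
      invFun := fun s => ⟨(s.1, s.2.1), s.2.2⟩
      left_inv := fun _ => rfl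
      right_inv := fun _ => rfl }
  rw [← Nat.card_coe_set_eq, Nat.card_congr e, Nat.card_sigma]
  simp only [Nat.card_coe_set_eq]

open Classical in
/-- Counting the solutions of a condition on `N a` by the values of `N`. -/
theorem ncard_comp_eq_sum {α β : Type*} [Finite α] [Fintype β] (N : α → β) (R : β → Prop) :
    {a | R (N a)}.ncard = ∑ y, if R y then {a | N a = y}.ncard else 0 := by
  have h := ncard_prod_eq_sum (fun (y : β) (a : α) => N a = y ∧ R y)
  have e : {a | R (N a)} ≃ {q : β × α | N q.2 = q.1 ∧ R q.1} :=
    { toFun := fun a => ⟨(N a, a), rfl, a.2⟩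
      invFun := fun q => ⟨q.1.2, by rw [Set.mem_ofPred_eq, q.2.1]; exact q.2.2⟩
      left_inv := fun _ => rfl
      right_inv := fun q => Subtype.ext (Prod.ext q.2.1 rfl) }
  rw [← Nat.card_coe_set_eq, Nat.card_congr e, Nat.card_coe_set_eq, h]
  refine Finset.sum_congr rfl fun y _ => ?_
  by_cases hy : R y <;> simp [hy]

/-- All fibres of a surjective homomorphism of finite groups have the same size. -/
theorem ncard_fiber_mul_card {A B : Type*} [AddGroup A] [AddGroup B] [Finite A] [Finite B]
    (g : A →+ B) (hg : Function.Surjective g) (c : B) :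
    {x | g x = c}.ncard * Nat.card B = Nat.card A := by
  classical
  have := Fintype.ofFinite A
  have := Fintype.ofFinite B
  have key : ∀ d, {x | g x = d}.ncard = {x | g x = c}.ncard := by
    intro d
    have := AddMonoidHom.card_fiber_eq_of_mem_range g (hg d) (hg c)
    simpa [Set.ncard_eq_toFinset_card'] using this
  have h := ncard_prod_eq_sum (fun (d : B) (x : A) => g x = d)
  simp only [key, Finset.sum_const, Finset.card_univ, smul_eq_mul] at h
  rw [Nat.card_eq_fintype_card (α := B), mul_comm, ← h, ← Nat.card_coe_set_eq]
  exact Nat.card_congr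
    { toFun := fun q => q.1.2
      invFun := fun x => ⟨(g x, x), rfl⟩
      left_inv := fun q => Subtype.ext (Prod.ext q.2 rfl)
      right_inv := fun _ => rfl }

/-! ### Hyperplanes of a finite field defined by the trace. -/

section Trace

variable {p : ℕ} [Fact p.Prime] {K : Type*} [Field K] [Finite K] [Algebra (ZMod p) K]

theorem exists_trace_mul_ne_zero {w : K} (hw : w ≠ 0) :
    ∃ b, Algebra.trace (ZMod p) K (w * b) ≠ 0 := by
  by_contra! h
  exact hw ((traceForm_nondegenerate (ZMod p) K).1 w h)

theorem ncard_trace_mul_eq {m : ℕ} (hm : 1 ≤ m) (hK : Nat.card K = p ^ m) {w : K} (hw : w ≠ 0)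
    (c : ZMod p) : {b | Algebra.trace (ZMod p) K (w * b) = c}.ncard = p ^ (m - 1) := by
  have hp0 : 0 < p := (Fact.out : p.Prime).pos
  let L : K →ₗ[ZMod p] ZMod p := Algebra.trace (ZMod p) K ∘ₗ LinearMap.mulLeft (ZMod p) w
  have hL : Function.Surjective L := by
    obtain ⟨b, hb⟩ := exists_trace_mul_ne_zero (p := p) hw
    exact L.surjective (fun h => hb (by simpa [L] using LinearMap.congr_fun h b))
  have h := ncard_fiber_mul_card L.toAddMonoidHom hL c
  rw [hK, Nat.card_zmod, ← Nat.sub_add_cancel hm, pow_succ] at h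
  exact Nat.eq_of_mul_eq_mul_right hp0 h

/-- By nondegeneracy of the trace form, independent `w₁`, `w₂` give independent functionals, so the
pair maps onto the plane over the prime field. A functional `φ` killing the image would be a linear
relation between `w₁` and `w₂`. -/
theorem ncard_trace_mul_eq_and_eq {m : ℕ} (hm : 2 ≤ m) (hK : Nat.card K = p ^ m) {w₁ w₂ : K}
    (hw₁ : w₁ ≠ 0) (hw : ∀ c : ZMod p, w₂ ≠ algebraMap (ZMod p) K c * w₁) (c₁ c₂ : ZMod p) :
    {b | Algebra.trace (ZMod p) K (w₁ * b) = c₁ ∧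
      Algebra.trace (ZMod p) K (w₂ * b) = c₂}.ncard = p ^ (m - 2) := by
  have hp0 : 0 < p := (Fact.out : p.Prime).pos
  let L : K →ₗ[ZMod p] ZMod p × ZMod p :=
    (Algebra.trace (ZMod p) K ∘ₗ LinearMap.mulLeft (ZMod p) w₁).prod
      (Algebra.trace (ZMod p) K ∘ₗ LinearMap.mulLeft (ZMod p) w₂)
  have hL : Function.Surjective L := by
    rw [← LinearMap.range_eq_top]
    by_contra hne
    obtain ⟨φ, hφ, hle⟩ := Submodule.exists_le_ker_of_lt_top _ (lt_top_iff_ne_top.2 hne)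
    have hφ' : ∀ x y, φ (x, y) = φ (1, 0) * x + φ (0, 1) * y := by
      intro x y
      have : ((x, y) : ZMod p × ZMod p) = x • ((1 : ZMod p), (0 : ZMod p)) + y • (0, 1) := by simp
      rw [this, map_add, map_smul, map_smul, smul_eq_mul, smul_eq_mul]
      ring
    set s := φ (1, 0)
    set t := φ (0, 1)
    have hrel : algebraMap (ZMod p) K s * w₁ + algebraMap (ZMod p) K t * w₂ = 0 := by
      by_contra h0
      obtain ⟨b, hb⟩ := exists_trace_mul_ne_zero (p := p) h0
      apply hb
      have := hle (LinearMap.mem_range_self L b)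
      rw [LinearMap.mem_ker] at this
      simp only [L, LinearMap.prod_apply, Function.prod, LinearMap.comp_apply,
        LinearMap.mulLeft_apply, hφ'] at this
      rw [← this, add_mul, map_add, mul_assoc, mul_assoc, ← Algebra.smul_def, ← Algebra.smul_def,
        map_smul, map_smul, smul_eq_mul, smul_eq_mul]
    by_cases ht : t = 0
    · rw [ht, map_zero, zero_mul, add_zero] at hrel
      have hs : s = 0 := by simpa [hw₁] using hrel
      exact hφ (LinearMap.ext fun q => by rw [← Prod.mk.eta (p := q), hφ', hs, ht]; simp)
    · have ht' : algebraMap (ZMod p) K t ≠ 0 := by simpa using ht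
      refine hw (-s / t) ?_
      rw [map_div₀, map_neg]
      field_simp
      linear_combination hrel
  have h := ncard_fiber_mul_card L.toAddMonoidHom hL (c₁, c₂)
  rw [hK, Nat.card_prod, Nat.card_zmod, ← Nat.sub_add_cancel hm, pow_add, pow_two p] at h
  have h' := Nat.eq_of_mul_eq_mul_right (Nat.mul_pos hp0 hp0) h
  rw [← h']
  congr 1
  ext b
  simp [L, Function.prod]

/-- An element whose square lies in the prime field lies in it, if the degree is odd. -/
theorem mem_range_algebraMap_of_sq (hp : p ≠ 2) {m : ℕ} (hm : Odd m) (hK : Nat.card K = p ^ m)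
    {t : K} {c : ZMod p} (h : t ^ 2 = algebraMap (ZMod p) K c) :
    ∃ s, algebraMap (ZMod p) K s = t := by
  have hpp : p.Prime := Fact.out
  have : CharP K p := charP_of_injective_algebraMap (algebraMap (ZMod p) K).injective p
  have := Fintype.ofFinite K
  have hsq : (t ^ p) ^ 2 = t ^ 2 := by rw [pow_right_comm, h, ← map_pow, ZMod.pow_card]
  have hfix : t ^ p = t := by
    rcases sq_eq_sq_iff_eq_or_eq_neg.1 hsq with h1 | h1
    · exact h1
    -- If Frobenius negates `t`, its `m`-th iterate, which is the identity, negates `t` as well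
    -- because `m` is odd.
    · have hpow : ∀ k : ℕ, t ^ p ^ k = (-1) ^ k * t := by
        intro k
        induction k with
        | zero => simp
        | succ k ih =>
          rw [pow_succ p, pow_mul, ih, mul_pow, ← pow_mul, mul_comm k, pow_mul,
            (hpp.odd_of_ne_two hp).neg_one_pow, h1]
          ring
      have ht := hpow m
      rw [← hK, Nat.card_eq_fintype_card, FiniteField.pow_card, hm.neg_one_pow] at ht
      rw [h1, ← neg_one_mul, ← ht]
  have hmem := (Subfield.mem_bot_iff_pow_eq_self K p).2 hfix
  rw [← ZMod.fieldRange_castHom_eq_bot p] at hmem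
  obtain ⟨s, hs⟩ := hmem
  exact ⟨s, by rw [← hs]; exact congrArg (fun g : ZMod p →+* K => g s) (Subsingleton.elim _ _)⟩

end Trace

/-! ### Fixed points of `θ` and the form `a ↦ Tr (w a θ(a))`. -/

section Automorphism

variable {p : ℕ} [Fact p.Prime] {K : Type*} [Field K] [Algebra (ZMod p) K]
  {θ : K ≃ₐ[ZMod p] K}

theorem apply_eq_self_of_apply_apply_eq_self {n : ℕ} (hn : Odd n) (hθn : θ ^ n = 1) {t : K}
    (h : θ (θ t) = t) : θ t = t := by
  obtain ⟨k, rfl⟩ := hn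
  have h2 : ∀ j : ℕ, (θ ^ (2 * j)) t = t := by
    intro j
    induction j with
    | zero => simp
    | succ j ih =>
      rw [mul_add, pow_add, AlgEquiv.mul_apply, mul_one, pow_two, AlgEquiv.mul_apply, h, ih]
  have := congrArg (fun g : K ≃ₐ[ZMod p] K => g t) hθn
  simpa [pow_succ', AlgEquiv.mul_apply, h2] using this

/-- The operator `θ - 1` and the fixed elements together span the field, if the order of `θ` is
prime to the characteristic. -/
theorem exists_eq_fixed_add_apply_sub {n : ℕ} (hpn : ¬ p ∣ n) (hθn : θ ^ n = 1) (w : K) :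
    ∃ x y, θ x = x ∧ w = x + (θ y - y) := by
  have : CharP K p := charP_of_injective_algebraMap (algebraMap (ZMod p) K).injective p
  have hn : (n : K) ≠ 0 := by rwa [Ne, CharP.cast_eq_zero_iff K p]
  have hn0 : 0 < n := Nat.pos_of_ne_zero (by rintro rfl; simp at hpn)
  obtain ⟨k, rfl⟩ := Nat.exists_eq_succ_of_ne_zero hn0.ne'
  have hθs : ∀ i : ℕ, θ ((θ ^ i) w) = (θ ^ (i + 1)) w := fun i => by
    rw [pow_succ', AlgEquiv.mul_apply]
  have hlast : (θ ^ (k + 1)) w = w := by rw [hθn]; rfl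
  set N := ∑ i ∈ Finset.range (k + 1), (θ ^ i) w with hN
  -- The weights `i` make `θ Y - Y` telescope to `n w - N`, with `n = k + 1` invertible in `K`;
  -- dividing by `n` gives the decomposition.
  set Y := ∑ i ∈ Finset.range (k + 1), (i : K) * (θ ^ i) w with hY
  have hNθ : θ N = N := by
    rw [hN, map_sum, Finset.sum_congr rfl fun i _ => hθs i, Finset.sum_range_succ, hlast,
      Finset.sum_range_succ' _ k]
    simp
  have hYθ : θ Y - Y = (k + 1 : ℕ) * w - N := by
    have h1 : θ Y = ∑ i ∈ Finset.range (k + 1), (i : K) * (θ ^ (i + 1)) w := by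
      rw [hY, map_sum]
      exact Finset.sum_congr rfl fun i _ => by rw [map_mul, map_natCast, hθs]
    rw [h1, Finset.sum_range_succ, hlast, hY, hN, Finset.sum_range_succ' _ k,
      Finset.sum_range_succ' _ k]
    have h2 : ∑ i ∈ Finset.range k, (((i + 1 : ℕ) : K)) * (θ ^ (i + 1)) w =
        ∑ i ∈ Finset.range k, (i : K) * (θ ^ (i + 1)) w +
        ∑ i ∈ Finset.range k, (θ ^ (i + 1)) w := by
      rw [← Finset.sum_add_distrib]
      exact Finset.sum_congr rfl fun i _ => by push_cast; ring
    rw [h2]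
    push_cast
    simp
    ring
  refine ⟨N / (k + 1 : ℕ), Y / (k + 1 : ℕ), ?_, ?_⟩
  · rw [map_div₀, map_natCast, hNθ]
  · rw [map_div₀, map_natCast, ← sub_div, hYθ]
    field_simp
    ring

variable [Finite K]

/-- The product `t θ(t)` is fixed by `θ`, so cancelling `θ(t)` gives `θ(θ(t)) = t`. Then `θ(t) = t`,
and `t` is a square root of `c`, which odd degree puts in the prime field. -/
theorem mem_range_algebraMap_of_mul_apply (hp : p ≠ 2) {m : ℕ} (hm : Odd m)
    (hK : Nat.card K = p ^ m) (hθ2 : ∀ t, θ (θ t) = t → θ t = t)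
    {t : K} {c : ZMod p} (hc : c ≠ 0) (h : t * θ t = algebraMap (ZMod p) K c) :
    ∃ s, algebraMap (ZMod p) K s = t ∧ s ^ 2 = c := by
  have hc' : algebraMap (ZMod p) K c ≠ 0 := by simpa using hc
  have hθt : θ t ≠ 0 := by rintro h0; rw [h0, mul_zero] at h; exact hc' h.symm
  have h1 : θ t * θ (θ t) = t * θ t := by
    rw [h, ← map_mul, h, AlgEquiv.commutes]
  have h2 : θ (θ t) = t := mul_left_cancel₀ hθt (by rw [h1, mul_comm])
  have h3 : t ^ 2 = algebraMap (ZMod p) K c := by rw [← h, hθ2 t h2, pow_two]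
  obtain ⟨s, rfl⟩ := mem_range_algebraMap_of_sq hp hm hK h3
  exact ⟨s, rfl, (algebraMap (ZMod p) K).injective (by rw [map_pow, h3])⟩

/-- The quadratic form `a ↦ Tr (w a θ(a))` over the prime field has as many zeros as a nonzero
linear form: a nonsquare `c` of the prime field interchanges the two cosets of squares, and
`a ↦ a θ(a)` is two-to-one onto the nonzero squares. -/
theorem ncard_trace_mul_apply_eq_zero (hp : p ≠ 2) {m : ℕ} (hm : Odd m)
    (hK : Nat.card K = p ^ m) (hθ2 : ∀ t, θ (θ t) = t → θ t = t) {w : K} (hw : w ≠ 0) :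
    {a | Algebra.trace (ZMod p) K (w * (a * θ a)) = 0}.ncard = p ^ (m - 1) := by
  classical
  have := Fintype.ofFinite K
  obtain ⟨c, hc⟩ := FiniteField.exists_nonsquare (F := ZMod p) (by rwa [ZMod.ringChar_zmod_n])
  have hc0 : c ≠ 0 := by rintro rfl; exact hc (IsSquare.zero)
  have hc0' : algebraMap (ZMod p) K c ≠ 0 := by simpa using hc0
  set γ := algebraMap (ZMod p) K c with hγ
  -- Equal values of `a θ(a)` force `a = ±b`. For nonzero `y` the two fibres cannot both be
  -- nonempty, since a quotient of their elements would give a square root of `c`; for `y = 0` each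
  -- fibre is `{0}`.
  have hfib : ∀ y, {a : K | a * θ a = y}.ncard + {a : K | γ * (a * θ a) = y}.ncard ≤ 2 := by
    intro y
    have hpm : ∀ a b : K, a * θ a = b * θ b → a = b ∨ a = -b := by
      intro a b hab
      by_cases hb : b = 0
      · left; simpa [hb] using hab
      · have hθb : θ b ≠ 0 := by simpa using hb
        obtain ⟨s, hs, hs2⟩ := mem_range_algebraMap_of_mul_apply (t := a / b) (c := 1) hp hm hK hθ2
          one_ne_zero (by rw [map_div₀, map_one]; field_simp; exact hab)
        have hs' : (s - 1) * (s + 1) = 0 := by linear_combination hs2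
        rcases mul_eq_zero.1 hs' with h | h
        · left
          rw [sub_eq_zero.1 h, map_one, eq_comm, div_eq_one_iff_eq hb] at hs
          exact hs
        · right
          rw [eq_neg_of_add_eq_zero_left h, map_neg, map_one, eq_comm, div_eq_iff hb] at hs
          rw [hs, neg_one_mul]
    have hne : ∀ a b : K, b ≠ 0 → a * θ a ≠ γ * (b * θ b) := by
      intro a b hb hab
      have hθb : θ b ≠ 0 := by simpa using hb
      obtain ⟨s, -, hs2⟩ := mem_range_algebraMap_of_mul_apply (t := a / b) (c := c) hp hm hK hθ2
        hc0 (by rw [map_div₀, ← hγ]; field_simp; rw [hab, mul_comm])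
      exact hc ⟨s, by rw [← hs2, pow_two]⟩
    have hpair : ∀ (S : Set K) (b : K), (∀ a ∈ S, a = b ∨ a = -b) → S.ncard ≤ 2 := fun S b h =>
      (Set.ncard_le_ncard (t := {b, -b}) (fun a ha => h a ha)).trans 
      ((Set.ncard_insert_le _ _).trans (by simp))
    by_cases hy : y = 0
    · have h1 : {a : K | a * θ a = y} = {0} := by ext a; simp [hy]
      have h2 : {a : K | γ * (a * θ a) = y} = {0} := by ext a; simp [hy, hc0']
      rw [h1, h2, Set.ncard_singleton]
    rcases Set.eq_empty_or_nonempty {a : K | γ * (a * θ a) = y} with h2 | ⟨b, hb⟩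
    · rw [h2, Set.ncard_empty, add_zero]
      rcases Set.eq_empty_or_nonempty {a : K | a * θ a = y} with h1 | ⟨b, hb⟩
      · simp [h1]
      · exact hpair _ b fun a ha => hpm a b (Eq.trans ha (Eq.symm hb))
    · have hb' : γ * (b * θ b) = y := hb
      have hb0 : b ≠ 0 := by rintro rfl; exact hy (by simpa using hb'.symm)
      have h1 : {a : K | a * θ a = y} = ∅ :=
        Set.eq_empty_of_forall_notMem fun a ha => hne a b hb0 (Eq.trans ha hb'.symm)
      rw [h1, Set.ncard_empty, zero_add]
      exact hpair _ b fun a ha => hpm a b (mul_left_cancel₀ hc0' (Eq.trans ha hb'.symm))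
  have htot : ∀ N : K → K, ∑ y, {a | N a = y}.ncard = Fintype.card K := by
    intro N
    have := ncard_comp_eq_sum N (fun _ => True)
    simpa [Set.ncard_univ, Nat.card_eq_fintype_card] using this.symm
  -- The bounds sum to twice the size of `K`, which is also the sum of the fibre sizes of the two
  -- maps, so every bound is attained.
  have hfib2 : ∀ y, {a : K | a * θ a = y}.ncard + {a : K | γ * (a * θ a) = y}.ncard = 2 := by
    have := (Finset.sum_eq_sum_iff_of_le (s := Finset.univ) fun y _ => hfib y).1 (by
      rw [Finset.sum_add_distrib, htot, htot]; simp [mul_two])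
    exact fun y => this y (Finset.mem_univ y)
  let R : K → Prop := fun y => Algebra.trace (ZMod p) K (w * y) = 0
  have hsum : {a : K | R (a * θ a)}.ncard + {a : K | R (γ * (a * θ a))}.ncard =
      2 * {y | R y}.ncard := by
    rw [ncard_comp_eq_sum (fun a => a * θ a) R, ncard_comp_eq_sum (fun a => γ * (a * θ a)) R,
      ← Finset.sum_add_distrib, Set.ncard_eq_toFinset_card', Set.toFinset_ofPred,
      Finset.card_filter, Finset.mul_sum]
    refine Finset.sum_congr rfl fun y _ => ?_
    by_cases h : R y
    · rw [if_pos h, if_pos h, if_pos h, mul_one, hfib2 y]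
    · rw [if_neg h, if_neg h, if_neg h, mul_zero, add_zero]
  have hsame : {a : K | R (γ * (a * θ a))} = {a : K | R (a * θ a)} := by
    ext a
    simp only [R, Set.mem_ofPred_eq]
    rw [mul_left_comm, hγ, ← Algebra.smul_def, map_smul, smul_eq_mul]
    simp [hc0]
  have hlin := ncard_trace_mul_eq hm.pos hK hw (0 : ZMod p)
  rw [hsame] at hsum
  change {y | R y}.ncard = p ^ (m - 1) at hlin
  change {a : K | R (a * θ a)}.ncard = p ^ (m - 1)
  omega

end Automorphism

/-! ### Partial difference sets and central subsets -/

theorem ncard_sdiff_singleton_add {α : Type*} [Finite α] (S : Set α) (x : α) [Decidable (x ∈ S)] :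
    (S \ {x}).ncard + (if x ∈ S then 1 else 0) = S.ncard := by
  split_ifs with h
  · exact Set.ncard_sdiff_singleton_add_one h
  · rw [Set.sdiff_singleton_eq_self h, add_zero]

/-- The difference condition in terms of the number of `h ∈ D` with `g * h ∈ D`. -/
theorem IsPDS.of_ncard_translate {G : Type*} [Group G] [Finite G] {D : Set G} {v k lam mu : ℤ}
    (hv : (Nat.card G : ℤ) = v) (hk : (D.ncard : ℤ) = k)
    (hmem : ∀ g, g ≠ 1 → g ∈ D → ({h | h ∈ D ∧ g * h ∈ D}.ncard : ℤ) = lam)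
    (hnot : ∀ g, g ≠ 1 → g ∉ D → ({h | h ∈ D ∧ g * h ∈ D}.ncard : ℤ) = mu) :
    IsPDS D v k lam mu := by
  have key : ∀ g : G, g ≠ 1 → {q : G × G | q.1 ∈ D ∧ q.2 ∈ D ∧ q.1 ≠ q.2 ∧
      q.1 * q.2⁻¹ = g}.ncard = {h | h ∈ D ∧ g * h ∈ D}.ncard := by
    intro g hg
    rw [← Nat.card_coe_set_eq, ← Nat.card_coe_set_eq]
    refine Nat.card_congr
      { toFun := fun q => ⟨q.1.2, q.2.2.1, ?_⟩
        invFun := fun h => ⟨(g * h.1, h.1), h.2.2, h.2.1, ?_, ?_⟩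
        left_inv := ?_
        right_inv := ?_ }
    · obtain ⟨⟨a, b⟩, ha, hb, hne, rfl⟩ := q
      simpa using ha
    · simpa using hg
    · simp
    · rintro ⟨⟨a, b⟩, ha, hb, hne, rfl⟩
      simp
    · intro h; rfl
  exact ⟨inferInstance, hv, hk, fun g hg h => by rw [key g hg, hmem g hg h],
    fun g hg h => by rw [key g hg, hnot g hg h]⟩

theorem IsCentralSubset.of_conj {G : Type*} [Group G] {D : Set G}
    (h : ∀ c g, g ∈ D → c * g * c⁻¹ ∈ D) : IsCentralSubset D := by
  refine ⟨{C | ∃ g ∈ D, ConjClasses.mk g = C}, ?_⟩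
  ext g
  simp only [Set.mem_iUnion, exists_prop, ConjClasses.mem_carrier_iff_mk_eq]
  constructor
  · exact fun hg => ⟨_, ⟨g, hg, rfl⟩, rfl⟩
  · rintro ⟨_, ⟨x, hx, rfl⟩, hgx⟩
    obtain ⟨c, rfl⟩ := isConj_iff.1 (ConjClasses.mk_eq_mk_iff_isConj.1 hgx.symm)
    exact h c x hx

/-! ### The two sets described by the trace of `K`. -/

namespace SuzukiGroup

variable {p : ℕ} [Fact p.Prime] {K : Type*} [Field K] [Algebra (ZMod p) K]
  {θ : K ≃ₐ[ZMod p] K}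

/-- The underlying set of the group is `K × K`. -/
def equivProd (θ : K ≃ₐ[ZMod p] K) : SuzukiGroup θ ≃ K × K where
  toFun g := (g.fst, g.snd)
  invFun q := ⟨q.1, q.2⟩
  left_inv _ := rfl
  right_inv _ := rfl

instance [Finite K] : Finite (SuzukiGroup θ) := Finite.of_equiv _ (equivProd θ).symm

theorem ncard_eq_sum [Fintype K] (S : Set (SuzukiGroup θ)) :
    S.ncard = ∑ a, {b | (⟨a, b⟩ : SuzukiGroup θ) ∈ S}.ncard := by
  rw [← ncard_prod_eq_sum fun a b => (⟨a, b⟩ : SuzukiGroup θ) ∈ S,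
    ← Nat.card_coe_set_eq, ← Nat.card_coe_set_eq]
  exact Nat.card_congr ((equivProd θ).subtypeEquiv fun g => Iff.rfl)

theorem mem_fixedField_iff {x : K} : x ∈ fixedField θ ↔ θ x = x := by
  rw [IntermediateField.mem_fixedField_iff]
  constructor
  · exact fun h => h θ (Subgroup.mem_zpowers θ)
  · intro h g hg
    have hle : Subgroup.zpowers θ ≤ MulAction.stabilizer (K ≃ₐ[ZMod p] K) x := by
      rw [Subgroup.zpowers_le]; exact h
    exact hle hg

theorem mem_kerPhi_iff {z x : fixedField θ} :
    x ∈ kerPhi θ z ↔ Algebra.trace (ZMod p) (fixedField θ) (z * x) = 0 := by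
  rw [kerPhi, Set.mem_ofPred_eq, phi, ← AddChar.map_zero_eq_one (ZMod.stdAddChar (N := p)),
    ZMod.injective_stdAddChar.eq_iff]

theorem trace_mul_apply_sub {z : K} (hz : θ z = z) (y : K) :
    Algebra.trace (ZMod p) K (z * (θ y - y)) = 0 := by
  have h := Algebra.trace_eq_of_algEquiv θ (z * y)
  rw [map_mul, hz] at h
  rw [mul_sub, map_sub, h, sub_self]

theorem mem_D'_iff {z : fixedField θ} {g : SuzukiGroup θ} :
    g ∈ D' θ z ↔ (g.fst = 0 ∧ g.snd ≠ 0) ∨ g ∈ D θ z := by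
  rw [D', Set.mem_union]
  refine or_congr_left ?_
  simp only [Set.mem_iUnion, Set.mem_ofPred_eq, exists_prop, centralClass, Set.mem_singleton_iff]
  constructor
  · rintro ⟨b, hb, rfl⟩; exact ⟨rfl, hb⟩
  · rintro ⟨h, hb⟩; exact ⟨g.snd, hb, SuzukiGroup.ext h rfl⟩

variable [Finite K]

/-- The absolute trace on the fixed field is, up to a unit, the restriction of the one on `K`. -/
theorem trace_coe_eq_zero_iff (hθ : ¬ p ∣ orderOf θ) (x : fixedField θ) :
    Algebra.trace (ZMod p) K (x : K) = 0 ↔ Algebra.trace (ZMod p) (fixedField θ) x = 0 := by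
  have h1 : Algebra.trace (ZMod p) K (x : K) =
      orderOf θ * Algebra.trace (ZMod p) (fixedField θ) x := by
    rw [← Algebra.trace_trace (S := fixedField θ)]
    change Algebra.trace (ZMod p) (fixedField θ)
      (Algebra.trace (fixedField θ) K (algebraMap (fixedField θ) K x)) = _
    rw [Algebra.trace_algebraMap, IntermediateField.finrank_fixedField_eq_card, Nat.card_zpowers,
      map_nsmul, nsmul_eq_mul]
  have h2 : ((orderOf θ : ℕ) : ZMod p) ≠ 0 := by rwa [Ne, ZMod.natCast_eq_zero_iff]
  rw [h1, mul_eq_zero, or_iff_right h2]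

/-- Dividing by `a θ(a)` turns `commMap θ a y` into `θ(y/a) - y/a`, which `trace_mul_apply_sub`
kills; only the fixed part `x` is seen by the trace. The converse decomposes `b / (a θ(a))`. -/
theorem mem_D_iff (hθ : ¬ p ∣ orderOf θ) {z : fixedField θ} {g : SuzukiGroup θ} :
    g ∈ D θ z ↔ g.fst ≠ 0 ∧
      Algebra.trace (ZMod p) K ((z : K) / (g.fst * θ g.fst) * g.snd) = 0 := by
  have hz : θ (z : K) = z := mem_fixedField_iff.1 z.2
  simp only [D, Set.mem_iUnion, Set.mem_ofPred_eq, exists_prop, nonCentralClass,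
    Set.exists_range_iff, commMap]
  constructor
  · rintro ⟨a, ha, x, hx, y, rfl⟩
    refine ⟨ha, ?_⟩
    have hθa : θ a ≠ 0 := by simpa using ha
    have h1 : (z : K) / (a * θ a) * (a * θ a * x + (a * θ y - y * θ a)) =
        ((z * x : fixedField θ) : K) + z * (θ (y / a) - y / a) := by
      rw [map_div₀]; push_cast; field_simp
    change Algebra.trace (ZMod p) K
      ((z : K) / (a * θ a) * (a * θ a * x + (a * θ y - y * θ a))) = 0
    rw [h1, map_add, trace_mul_apply_sub hz, add_zero, trace_coe_eq_zero_iff hθ]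
    exact mem_kerPhi_iff.1 hx
  · rintro ⟨ha, ht⟩
    obtain ⟨a, b⟩ := g
    have hθa : θ a ≠ 0 := by simpa using ha
    obtain ⟨x, y, hx, hxy⟩ := exists_eq_fixed_add_apply_sub hθ (pow_orderOf_eq_one θ) (b / (a * θ a))
    refine ⟨a, ha, ⟨x, mem_fixedField_iff.2 hx⟩, ?_, a * y, ?_⟩
    · have h1 : (z : K) / (a * θ a) * b = z * x + z * (θ y - y) := by
        rw [← mul_add, ← hxy, div_mul_eq_mul_div, mul_div_assoc]
      rw [mem_kerPhi_iff, ← trace_coe_eq_zero_iff hθ]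
      rwa [h1, map_add, trace_mul_apply_sub hz, add_zero] at ht
    · ext
      · rfl
      · change b = a * θ a * x + (a * θ (a * y) - a * y * θ a)
        rw [div_eq_iff (mul_ne_zero ha hθa)] at hxy
        rw [hxy, map_mul]; ring

/-! ### The two sets are closed under inversion and conjugation -/

theorem isRegularSubset_D (hθ : ¬ p ∣ orderOf θ) {z : fixedField θ}
    (hz : Algebra.trace (ZMod p) K (z : K) = 0) : IsRegularSubset (D θ z) := by
  refine ⟨fun h => ((mem_D_iff hθ).1 h).1 rfl, fun g => ?_⟩
  rw [mem_D_iff hθ, mem_D_iff hθ, fst_inv, snd_inv, neg_ne_zero]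
  refine and_congr_right fun ha => ?_
  have hθa : θ g.fst ≠ 0 := by simpa using ha
  -- The correction term of the inverse contributes exactly `z`, of trace zero.
  have h1 : (z : K) / (-g.fst * θ (-g.fst)) * (-g.snd + g.fst * θ g.fst) =
      z - (z : K) / (g.fst * θ g.fst) * g.snd := by
    rw [map_neg]; field_simp; ring
  rw [h1, map_sub, hz, zero_sub, neg_eq_zero]

theorem isRegularSubset_D' (hθ : ¬ p ∣ orderOf θ) {z : fixedField θ}
    (hz : Algebra.trace (ZMod p) K (z : K) = 0) : IsRegularSubset (D' θ z) := by
  obtain ⟨h1, h2⟩ := isRegularSubset_D hθ hz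
  refine ⟨fun h => ?_, fun g => ?_⟩
  · rcases mem_D'_iff.1 h with h | h
    · exact h.2 rfl
    · exact h1 h
  · rw [mem_D'_iff, mem_D'_iff, h2 g]
    refine or_congr_left ?_
    rw [fst_inv, snd_inv, neg_eq_zero]
    refine and_congr_right fun ha => ?_
    simp [ha]

theorem isCentralSubset_D (hθ : ¬ p ∣ orderOf θ) (z : fixedField θ) :
    IsCentralSubset (D θ z) := by
  have hz : θ (z : K) = z := mem_fixedField_iff.1 z.2
  refine IsCentralSubset.of_conj fun c g hg => ?_
  obtain ⟨ha, ht⟩ := (mem_D_iff hθ).1 hg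
  have hθa : θ g.fst ≠ 0 := by simpa using ha
  have hfst : (c * g * c⁻¹).fst = g.fst := by simp
  rw [mem_D_iff hθ, hfst]
  refine ⟨ha, ?_⟩
  have h1 : (z : K) / (g.fst * θ g.fst) * (c * g * c⁻¹).snd =
      (z : K) / (g.fst * θ g.fst) * g.snd - z * (θ (c.fst / g.fst) - c.fst / g.fst) := by
    simp only [snd_mul, snd_inv, fst_mul, fst_inv, map_neg, map_div₀]
    field_simp
    ring
  rw [h1, map_sub, ht, trace_mul_apply_sub hz, sub_zero]

theorem isCentralSubset_D' (hθ : ¬ p ∣ orderOf θ) (z : fixedField θ) :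
    IsCentralSubset (D' θ z) := by
  obtain ⟨S, hS⟩ := isCentralSubset_D hθ z
  refine IsCentralSubset.of_conj fun c g hg => ?_
  rw [mem_D'_iff] at hg ⊢
  rcases hg with ⟨h1, h2⟩ | hg
  · left
    simp only [snd_mul, snd_inv, fst_mul, fst_inv, map_neg, h1]
    refine ⟨by ring, ?_⟩
    convert h2 using 1
    simp only [add_zero, map_zero, mul_zero]
    ring
  · right
    rw [hS] at hg ⊢
    simp only [Set.mem_iUnion, exists_prop, ConjClasses.mem_carrier_iff_mk_eq] at hg ⊢
    obtain ⟨C, hC, rfl⟩ := hg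
    exact ⟨_, hC, ConjClasses.mk_eq_mk_iff_isConj.2 (isConj_iff.2 ⟨c, rfl⟩).symm⟩

end SuzukiGroup

namespace SuzukiGroup

variable {p : ℕ} [Fact p.Prime] {K : Type*} [Field K] [Algebra (ZMod p) K]
  {θ : K ≃ₐ[ZMod p] K}

/-! ### Counting the translates -/

theorem natCard_eq {m : ℕ} (hK : Nat.card K = p ^ m) :
    Nat.card (SuzukiGroup θ) = p ^ (2 * m) := by
  rw [Nat.card_congr (equivProd θ), Nat.card_prod, hK, two_mul, pow_add]

theorem div_mul_apply_ne_zero {z : fixedField θ} (hz : z ≠ 0) {a : K} (ha : a ≠ 0) :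
    (z : K) / (a * θ a) ≠ 0 := by
  have hθa : θ a ≠ 0 := by simpa using ha
  exact div_ne_zero (by simpa using hz) (mul_ne_zero ha hθa)

/-- Scaling `u` by `s` multiplies the trace by the unit `s⁻¹ ^ 2`, so the hyperplane is constant
along a prime field line. -/
theorem trace_div_mul_apply_smul_eq_zero_iff {s : ZMod p} (hs : s ≠ 0) (z u b : K) :
    Algebra.trace (ZMod p) K (z / (algebraMap (ZMod p) K s * u *
      θ (algebraMap (ZMod p) K s * u)) * b) = 0 ↔
      Algebra.trace (ZMod p) K (z / (u * θ u) * b) = 0 := by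
  have h : z / (algebraMap (ZMod p) K s * u * θ (algebraMap (ZMod p) K s * u)) * b =
      (s⁻¹ ^ 2) • (z / (u * θ u) * b) := by
    rw [Algebra.smul_def, map_mul, AlgEquiv.commutes, map_pow, map_inv₀]
    simp only [div_eq_mul_inv, mul_inv]
    ring
  rw [h, map_smul, smul_eq_mul, mul_eq_zero, or_iff_right (pow_ne_zero _ (inv_ne_zero hs))]

theorem slice_D'_translate (z : fixedField θ) (g : SuzukiGroup θ) {a : K} (ha : a ≠ 0)
    (hga : g.fst + a ≠ 0) :
    {b | (⟨a, b⟩ : SuzukiGroup θ) ∈ {h | h ∈ D' θ z ∧ g * h ∈ D' θ z}} =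
      {b | (⟨a, b⟩ : SuzukiGroup θ) ∈ {h | h ∈ D θ z ∧ g * h ∈ D θ z}} := by
  ext b
  simp [mem_D'_iff, ha, hga]

variable [Finite K]

theorem ncard_D (hθ : ¬ p ∣ orderOf θ) {m : ℕ} (hm : 1 ≤ m) (hK : Nat.card K = p ^ m)
    {z : fixedField θ} (hz : z ≠ 0) : ((D θ z).ncard : ℤ) = p ^ (m - 1) * (p ^ m - 1) := by
  classical
  have := Fintype.ofFinite K
  have hslice : ∀ a : K, {b | (⟨a, b⟩ : SuzukiGroup θ) ∈ D θ z}.ncard +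
      (if a = 0 then p ^ (m - 1) else 0) = p ^ (m - 1) := by
    intro a
    simp only [mem_D_iff hθ]
    by_cases ha : a = 0
    · simp [ha]
    · simp only [ha, if_false, add_zero, ne_eq, not_false_eq_true, true_and]
      exact ncard_trace_mul_eq hm hK (div_mul_apply_ne_zero hz ha) 0
  have hsum := Finset.sum_congr rfl fun (a : K) (_ : a ∈ Finset.univ) => hslice a
  rw [Finset.sum_add_distrib, ← ncard_eq_sum, Finset.sum_ite_eq' , if_pos (Finset.mem_univ _),
    Finset.sum_const, Finset.card_univ, ← Nat.card_eq_fintype_card, hK, smul_eq_mul] at hsum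
  zify at hsum
  linear_combination hsum

theorem ncard_D' (hθ : ¬ p ∣ orderOf θ) {m : ℕ} (hm : 1 ≤ m) (hK : Nat.card K = p ^ m)
    {z : fixedField θ} (hz : z ≠ 0) :
    ((D' θ z).ncard : ℤ) = (p ^ (m - 1) + 1) * (p ^ m - 1) := by
  classical
  have := Fintype.ofFinite K
  have hslice : ∀ a : K, {b | (⟨a, b⟩ : SuzukiGroup θ) ∈ D' θ z}.ncard =
      {b | (⟨a, b⟩ : SuzukiGroup θ) ∈ D θ z}.ncard + if a = 0 then p ^ m - 1 else 0 := by
    intro a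
    simp only [mem_D'_iff, mem_D_iff hθ]
    by_cases ha : a = 0
    · have h := ncard_sdiff_singleton_add (Set.univ : Set K) 0
      rw [if_pos (Set.mem_univ _), Set.ncard_univ, hK] at h
      have h1 : {b : K | b ≠ 0} = Set.univ \ {0} := by ext; simp
      simp only [ha, if_true, true_and, ne_eq, not_true_eq_false, false_and, or_false]
      change {b : K | b ≠ 0}.ncard = _
      rw [h1, Set.ofPred_false, Set.ncard_empty, zero_add]
      omega
    · simp [ha]
  have hD := ncard_D hθ hm hK hz
  have hpos : 1 ≤ p ^ m := Nat.one_le_pow _ _ (Fact.out : p.Prime).pos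
  rw [ncard_eq_sum, Finset.sum_congr rfl fun a _ => hslice a, Finset.sum_add_distrib,
    ← ncard_eq_sum, Finset.sum_ite_eq', if_pos (Finset.mem_univ _)]
  push_cast [hpos]
  rw [hD]
  ring

/-- The slice over `a` of the set of `h ∈ D θ z` with `g * h ∈ D θ z`. -/
theorem slice_D_translate (hθ : ¬ p ∣ orderOf θ) (z : fixedField θ) (g : SuzukiGroup θ) (a : K) :
    {b | (⟨a, b⟩ : SuzukiGroup θ) ∈ {h | h ∈ D θ z ∧ g * h ∈ D θ z}} =
      {b | (a ≠ 0 ∧ Algebra.trace (ZMod p) K ((z : K) / (a * θ a) * b) = 0) ∧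
        g.fst + a ≠ 0 ∧ Algebra.trace (ZMod p) K
          ((z : K) / ((g.fst + a) * θ (g.fst + a)) * (g.snd + b + g.fst * θ a)) = 0} := by
  ext b
  simp only [Set.mem_ofPred_eq, mem_D_iff hθ, fst_mul, snd_mul]

/-- Translates by a central element. -/
theorem ncard_translate_D_of_fst_eq_zero (hp : p ≠ 2) (hθ : ¬ p ∣ orderOf θ)
    (hθ2 : ∀ t, θ (θ t) = t → θ t = t) {m : ℕ} (hm : Odd m) (hK : Nat.card K = p ^ m)
    {z : fixedField θ} (hz : z ≠ 0) {g : SuzukiGroup θ} (hg : g.fst = 0) (hg' : g.snd ≠ 0) :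
    ({h | h ∈ D θ z ∧ g * h ∈ D θ z}.ncard : ℤ) = p ^ (2 * (m - 1)) - p ^ (m - 1) := by
  classical
  have := Fintype.ofFinite K
  have hzK : (z : K) ≠ 0 := by simpa using hz
  set R : K → Prop := fun a => Algebra.trace (ZMod p) K ((z : K) / (a * θ a) * g.snd) = 0 with hR
  -- Division by zero gives 0, so `R` holds at `a = 0`, where the slice is empty; the extra term in
  -- `hslice` compensates for this.
  have hR0 : R 0 := by simp [hR]
  have hslice : ∀ a : K, {b | (⟨a, b⟩ : SuzukiGroup θ) ∈ {h | h ∈ D θ z ∧ g * h ∈ D θ z}}.ncard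
      + (if a = 0 then p ^ (m - 1) else 0) = (if R a then 1 else 0) * p ^ (m - 1) := by
    intro a
    rw [slice_D_translate hθ, hg]
    by_cases ha : a = 0
    · rw [ha, if_pos hR0, if_pos rfl]; simp
    rw [if_neg ha, add_zero, ← ncard_trace_mul_eq hm.pos hK (div_mul_apply_ne_zero hz ha) 0]
    split_ifs with h
    · rw [Nat.one_mul]
      congr 1
      ext b
      simp only [Set.mem_ofPred_eq, zero_add, zero_mul, add_zero, mul_add, map_add]
      simp only [hR] at h
      simp [ha, h]
    · rw [Nat.zero_mul, Set.ncard_eq_zero]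
      ext b
      simp only [Set.mem_ofPred_eq, zero_add, zero_mul, add_zero, mul_add, map_add,
        Set.mem_empty_iff_false, iff_false]
      rintro ⟨⟨-, h1⟩, -, h2⟩
      rw [h1, add_zero] at h2
      exact h h2
  have hcount : ∑ a : K, (if R a then 1 else 0) = p ^ (m - 1) := by
    rw [← Finset.card_filter, ← ncard_trace_mul_apply_eq_zero hp hm hK hθ2 (mul_ne_zero hzK hg'),
      ← Set.toFinset_ofPred, ← Set.ncard_eq_toFinset_card', ← Nat.card_coe_set_eq,
      ← Nat.card_coe_set_eq]
    -- Inversion of `a`, fixing 0, moves `a θ(a)` from the denominator to the numerator.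
    refine Nat.card_congr ((Equiv.inv K).subtypeEquiv fun a => ?_)
    simp only [hR, Set.mem_ofPred_eq, Equiv.inv_apply, map_inv₀]
    rw [← mul_inv, div_eq_mul_inv, mul_right_comm]
  have hsum := Finset.sum_congr rfl fun (a : K) (_ : a ∈ Finset.univ) => hslice a
  rw [Finset.sum_add_distrib, ← ncard_eq_sum, Finset.sum_ite_eq', if_pos (Finset.mem_univ _),
    ← Finset.sum_mul, hcount] at hsum
  zify at hsum
  rw [two_mul, pow_add]
  linear_combination hsum

open Classical in
/-- Slices over the prime field line spanned by the first coordinate of `g`. -/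
theorem ncard_slice_of_mem_line (hθ : ¬ p ∣ orderOf θ) {m : ℕ} (hm : 1 ≤ m)
    (hK : Nat.card K = p ^ m) {z : fixedField θ} (hz : z ≠ 0)
    (hztr : Algebra.trace (ZMod p) K (z : K) = 0) {g : SuzukiGroup θ} (hg : g.fst ≠ 0)
    (s : ZMod p) :
    {b | (⟨algebraMap (ZMod p) K s * g.fst, b⟩ : SuzukiGroup θ) ∈
        {h | h ∈ D θ z ∧ g * h ∈ D θ z}}.ncard =
      if s ≠ 0 ∧ s ≠ -1 then (if g ∈ D θ z then p ^ (m - 1) else 0) else 0 := by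
  have hθg : θ g.fst ≠ 0 := by simpa using hg
  have hsum : g.fst + algebraMap (ZMod p) K s * g.fst = algebraMap (ZMod p) K (1 + s) * g.fst := by
    rw [map_add, map_one]; ring
  have hs0 : algebraMap (ZMod p) K s * g.fst ≠ 0 ↔ s ≠ 0 := by simp [hg]
  have hs1 : algebraMap (ZMod p) K (1 + s) * g.fst ≠ 0 ↔ s ≠ -1 := by
    rw [mul_ne_zero_iff, and_iff_left hg, _root_.map_ne_zero, Ne, Ne, add_comm,
      add_eq_zero_iff_eq_neg]
  rw [slice_D_translate hθ, hsum]
  simp only [hs0, hs1]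
  by_cases h0 : s = 0
  · simp [h0]
  by_cases h1 : s = -1
  · simp [h1]
  have h1' : 1 + s ≠ 0 := by rwa [Ne, add_comm, add_eq_zero_iff_eq_neg]
  -- The cross term of the group law contributes `s • z`, of trace zero, so the second condition
  -- differs from the first only by the constant that decides whether `g ∈ D θ z`.
  have hexp : ∀ b, Algebra.trace (ZMod p) K ((z : K) / (g.fst * θ g.fst) *
      (g.snd + b + g.fst * θ (algebraMap (ZMod p) K s * g.fst))) =
      Algebra.trace (ZMod p) K ((z : K) / (g.fst * θ g.fst) * g.snd) +
      Algebra.trace (ZMod p) K ((z : K) / (g.fst * θ g.fst) * b) := by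
    intro b
    have : (z : K) / (g.fst * θ g.fst) *
        (g.snd + b + g.fst * θ (algebraMap (ZMod p) K s * g.fst)) =
        (z : K) / (g.fst * θ g.fst) * g.snd + (z : K) / (g.fst * θ g.fst) * b + s • (z : K) := by
      rw [map_mul, AlgEquiv.commutes, Algebra.smul_def]; field_simp
    rw [this, map_add, map_add, map_smul, hztr, smul_zero, add_zero]
  simp only [trace_div_mul_apply_smul_eq_zero_iff h0, trace_div_mul_apply_smul_eq_zero_iff h1',
    hexp, mem_D_iff hθ, ← ncard_trace_mul_eq hm hK (div_mul_apply_ne_zero hz hg) 0]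
  by_cases ht : Algebra.trace (ZMod p) K ((z : K) / (g.fst * θ g.fst) * g.snd) = 0
  · simp [h0, h1, hg, ht]
  · rw [if_pos ⟨h0, h1⟩, if_neg (fun h => ht h.2), Set.ncard_eq_zero]
    ext b
    simp only [Set.mem_ofPred_eq, Set.mem_empty_iff_false, iff_false]
    rintro ⟨⟨-, h2⟩, -, h3⟩
    rw [h2, add_zero] at h3
    exact ht h3

/-- Slices over the complement of the prime field line spanned by the first coordinate of `g`. -/
theorem ncard_slice_of_notMem_line (hp : p ≠ 2) (hθ : ¬ p ∣ orderOf θ)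
    (hθ2 : ∀ t, θ (θ t) = t → θ t = t) {m : ℕ} (hm2 : 2 ≤ m) (hm : Odd m)
    (hK : Nat.card K = p ^ m) {z : fixedField θ} (hz : z ≠ 0) {g : SuzukiGroup θ}
    (hg : g.fst ≠ 0) {a : K} (ha : ∀ s : ZMod p, algebraMap (ZMod p) K s * g.fst ≠ a) :
    {b | (⟨a, b⟩ : SuzukiGroup θ) ∈ {h | h ∈ D θ z ∧ g * h ∈ D θ z}}.ncard = p ^ (m - 2) := by
  have ha0 : a ≠ 0 := by simpa [eq_comm] using ha 0
  have hga : g.fst + a ≠ 0 := by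
    intro h
    refine ha (-1) ?_
    rw [map_neg, map_one, neg_one_mul, eq_neg_of_add_eq_zero_right h]
  have hzK : (z : K) ≠ 0 := by simpa using hz
  have hθa : θ a ≠ 0 := by simpa using ha0
  have hθga : θ (g.fst + a) ≠ 0 := by rw [_root_.map_ne_zero]; exact hga
  set w₁ := (z : K) / (a * θ a) with hw₁
  set w₂ := (z : K) / ((g.fst + a) * θ (g.fst + a)) with hw₂
  have hind : ∀ c : ZMod p, w₂ ≠ algebraMap (ZMod p) K c * w₁ := by
    intro c hc
    have hc0 : c ≠ 0 := by
      rintro rfl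
      rw [map_zero, zero_mul] at hc
      exact div_mul_apply_ne_zero hz hga hc
    obtain ⟨s, hs, -⟩ := mem_range_algebraMap_of_mul_apply (t := a / (g.fst + a)) hp hm hK hθ2 hc0
      (by
        rw [hw₁, hw₂] at hc
        rw [map_div₀]
        field_simp at hc ⊢
        linear_combination hc)
    rw [eq_div_iff hga] at hs
    have hs1 : s ≠ 1 := by
      rintro rfl
      rw [map_one, one_mul, add_eq_right] at hs
      exact hg hs
    have hs1' : (1 : K) - algebraMap (ZMod p) K s ≠ 0 := by
      rw [← map_one (algebraMap (ZMod p) K), ← map_sub, _root_.map_ne_zero]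
      exact sub_ne_zero.2 hs1.symm
    -- This solves `s * (g.fst + a) = a` for `a / g.fst`.
    refine ha (s / (1 - s)) ?_
    rw [map_div₀, map_sub, map_one]
    field_simp
    linear_combination hs
  rw [slice_D_translate hθ, ← ncard_trace_mul_eq_and_eq hm2 hK (div_mul_apply_ne_zero hz ha0) hind
    0 (-Algebra.trace (ZMod p) K (w₂ * (g.snd + g.fst * θ a)))]
  congr 1
  ext b
  have : w₂ * (g.snd + b + g.fst * θ a) = w₂ * b + w₂ * (g.snd + g.fst * θ a) := by ring
  simp only [Set.mem_ofPred_eq, ne_eq, ha0, hga, not_false_eq_true, true_and]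
  rw [← hw₁, ← hw₂, this, map_add, add_eq_zero_iff_eq_neg]

open Classical in
/-- Translates by a noncentral element. -/
theorem ncard_translate_D_of_fst_ne_zero (hp : p ≠ 2) (hθ : ¬ p ∣ orderOf θ)
    (hθ2 : ∀ t, θ (θ t) = t → θ t = t) {m : ℕ} (hm2 : 2 ≤ m) (hm : Odd m)
    (hK : Nat.card K = p ^ m) {z : fixedField θ} (hz : z ≠ 0)
    (hztr : Algebra.trace (ZMod p) K (z : K) = 0) {g : SuzukiGroup θ} (hg : g.fst ≠ 0) :
    ({h | h ∈ D θ z ∧ g * h ∈ D θ z}.ncard : ℤ) = p ^ (2 * (m - 1)) - p ^ (m - 1) +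
      if g ∈ D θ z then ((p : ℤ) - 2) * p ^ (m - 1) else 0 := by
  have := Fintype.ofFinite K
  have hinj : Function.Injective fun s : ZMod p => algebraMap (ZMod p) K s * g.fst := by
    intro s t h
    exact (algebraMap (ZMod p) K).injective (mul_right_cancel₀ hg h)
  set L : Finset K := Finset.univ.map ⟨_, hinj⟩ with hL
  have hLcard : L.card = p := by rw [hL, Finset.card_map, Finset.card_univ, ZMod.card]
  have hcompl : (Lᶜ).card + p = p ^ m := by
    have := Finset.card_compl_add_card L
    rwa [hLcard, ← Nat.card_eq_fintype_card, hK] at this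
  have htwo : (Finset.univ.filter fun s : ZMod p => s ≠ 0 ∧ s ≠ -1).card + 2 = p := by
    have h1 : (Finset.univ.filter fun s : ZMod p => s ≠ 0 ∧ s ≠ -1) =
        ({0, -1} : Finset (ZMod p))ᶜ := by
      ext s; simp
    have h2 : ({0, -1} : Finset (ZMod p)).card = 2 := Finset.card_pair (by simp)
    have := Finset.card_compl_add_card ({0, -1} : Finset (ZMod p))
    rwa [h2, ZMod.card, ← h1] at this
  have hsum : {h | h ∈ D θ z ∧ g * h ∈ D θ z}.ncard = (Finset.univ.filter fun s : ZMod p =>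
      s ≠ 0 ∧ s ≠ -1).card * (if g ∈ D θ z then p ^ (m - 1) else 0) +
      (Lᶜ).card * p ^ (m - 2) := by
    rw [ncard_eq_sum, ← Finset.sum_add_sum_compl L]
    congr 1
    · rw [hL, Finset.sum_map]
      simp only [Function.Embedding.coeFn_mk]
      rw [Finset.sum_congr rfl fun s _ =>
        ncard_slice_of_mem_line hθ (by omega) hK hz hztr hg s, ← Finset.sum_filter,
        Finset.sum_const, smul_eq_mul]
    · rw [Finset.sum_congr rfl fun a ha => ncard_slice_of_notMem_line hp hθ hθ2 hm2 hm hK hz hg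
        (a := a) ?_, Finset.sum_const, smul_eq_mul]
      intro s hs
      rw [Finset.mem_compl, hL, Finset.mem_map] at ha
      exact ha ⟨s, Finset.mem_univ _, hs⟩
  obtain ⟨k, rfl⟩ := Nat.exists_eq_add_of_le' hm2
  have e1 : k + 2 - 1 = k + 1 := rfl
  have e2 : k + 2 - 2 = k := rfl
  rw [hsum, e1, e2]
  zify at hcompl htwo
  push_cast
  split_ifs
  · linear_combination (p : ℤ) ^ k * hcompl + (p : ℤ) ^ (k + 1) * htwo
  · linear_combination (p : ℤ) ^ k * hcompl

theorem slice_D_translate_eq_empty (hθ : ¬ p ∣ orderOf θ) (z : fixedField θ) (g : SuzukiGroup θ)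
    {a : K} (h : a = 0 ∨ g.fst + a = 0) :
    {b | (⟨a, b⟩ : SuzukiGroup θ) ∈ {h | h ∈ D θ z ∧ g * h ∈ D θ z}} = ∅ := by
  rw [slice_D_translate hθ]
  rcases h with h | h <;> simp [h]

/-- Here the exceptional slices `a = 0` and `a = -g.fst` coincide; only `b = 0` and `b = -g.snd` are
missing from that slice. -/
theorem ncard_translate_D'_of_fst_eq_zero (hθ : ¬ p ∣ orderOf θ) {m : ℕ}
    (hK : Nat.card K = p ^ m) (z : fixedField θ) {g : SuzukiGroup θ} (hg : g.fst = 0)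
    (hg' : g.snd ≠ 0) :
    ({h | h ∈ D' θ z ∧ g * h ∈ D' θ z}.ncard : ℤ) =
      {h | h ∈ D θ z ∧ g * h ∈ D θ z}.ncard + (p ^ m - 2) := by
  classical
  have := Fintype.ofFinite K
  have hzero : {b | (⟨0, b⟩ : SuzukiGroup θ) ∈ {h | h ∈ D' θ z ∧ g * h ∈ D' θ z}}.ncard + 2 =
      p ^ m := by
    have h1 : {b | (⟨0, b⟩ : SuzukiGroup θ) ∈ {h | h ∈ D' θ z ∧ g * h ∈ D' θ z}} =
        ({0, -g.snd} : Set K)ᶜ := by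
      ext b
      simp [mem_D'_iff, mem_D_iff hθ, hg, add_comm g.snd, add_eq_zero_iff_eq_neg]
    rw [h1, ← hK, ← Set.ncard_pair (neg_ne_zero.2 hg').symm, add_comm, Set.ncard_add_ncard_compl]
  have hslice : ∀ a : K,
      {b | (⟨a, b⟩ : SuzukiGroup θ) ∈ {h | h ∈ D' θ z ∧ g * h ∈ D' θ z}}.ncard =
      {b | (⟨a, b⟩ : SuzukiGroup θ) ∈ {h | h ∈ D θ z ∧ g * h ∈ D θ z}}.ncard +
      if a = 0 then {b | (⟨0, b⟩ : SuzukiGroup θ) ∈ {h | h ∈ D' θ z ∧ g * h ∈ D' θ z}}.ncard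
        else 0 := by
    intro a
    by_cases ha : a = 0
    · rw [slice_D_translate_eq_empty hθ z g (Or.inl ha), if_pos ha, ha, Set.ncard_empty, zero_add]
    · rw [slice_D'_translate z g ha (by rwa [hg, zero_add]), if_neg ha, add_zero]
  rw [ncard_eq_sum, Finset.sum_congr rfl fun a _ => hslice a, Finset.sum_add_distrib,
    ← ncard_eq_sum, Finset.sum_ite_eq', if_pos (Finset.mem_univ _)]
  zify at hzero
  push_cast
  linear_combination hzero

-- Each of the exceptional slices `a = 0` and `a = -g.fst` is an affine hyperplane with one point
-- deleted, the point where `h` or `g * h` is the identity. That point lies on the hyperplane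
-- exactly when `g ∈ D θ z`; for the second slice this uses that `z` has trace zero.
open Classical in
theorem ncard_translate_D'_of_fst_ne_zero (hθ : ¬ p ∣ orderOf θ) {m : ℕ} (hm : 1 ≤ m)
    (hK : Nat.card K = p ^ m) {z : fixedField θ} (hz : z ≠ 0)
    (hztr : Algebra.trace (ZMod p) K (z : K) = 0) {g : SuzukiGroup θ} (hg : g.fst ≠ 0) :
    ({h | h ∈ D' θ z ∧ g * h ∈ D' θ z}.ncard : ℤ) =
      {h | h ∈ D θ z ∧ g * h ∈ D θ z}.ncard + 2 * (p ^ (m - 1) - if g ∈ D θ z then 1 else 0) := by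
  have := Fintype.ofFinite K
  have hθg : θ g.fst ≠ 0 := by simpa using hg
  set w := (z : K) / (g.fst * θ g.fst) with hw
  have hw0 : w ≠ 0 := div_mul_apply_ne_zero hz hg
  have hgD : g ∈ D θ z ↔ Algebra.trace (ZMod p) K (w * g.snd) = 0 := by
    rw [mem_D_iff hθ, and_iff_right hg]
  have hzero : {b | (⟨0, b⟩ : SuzukiGroup θ) ∈ {h | h ∈ D' θ z ∧ g * h ∈ D' θ z}}.ncard +
      (if g ∈ D θ z then 1 else 0) = p ^ (m - 1) := by
    have h1 : {b | (⟨0, b⟩ : SuzukiGroup θ) ∈ {h | h ∈ D' θ z ∧ g * h ∈ D' θ z}} =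
        {b | Algebra.trace (ZMod p) K (w * b) = -Algebra.trace (ZMod p) K (w * g.snd)} \ {0} := by
      ext b
      simp only [mem_D'_iff, mem_D_iff hθ, fst_mul, snd_mul, Set.mem_ofPred_eq, Set.mem_sdiff,
        Set.mem_singleton_iff, map_zero, mul_zero, add_zero, hg, ← hw, mul_add, map_add]
      rw [← add_eq_zero_iff_eq_neg, add_comm (Algebra.trace (ZMod p) K (w * b))]
      simp [and_comm, hg]
    have h2 : g ∈ D θ z ↔
        0 ∈ {b | Algebra.trace (ZMod p) K (w * b) = -Algebra.trace (ZMod p) K (w * g.snd)} := by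
      rw [hgD, Set.mem_ofPred_eq, mul_zero, map_zero, zero_eq_neg]
    rw [h1, if_congr h2 rfl rfl, ncard_sdiff_singleton_add, ncard_trace_mul_eq hm hK hw0]
  have hneg : {b | (⟨-g.fst, b⟩ : SuzukiGroup θ) ∈ {h | h ∈ D' θ z ∧ g * h ∈ D' θ z}}.ncard +
      (if g ∈ D θ z then 1 else 0) = p ^ (m - 1) := by
    have h1 : {b | (⟨-g.fst, b⟩ : SuzukiGroup θ) ∈ {h | h ∈ D' θ z ∧ g * h ∈ D' θ z}} =
        {b | Algebra.trace (ZMod p) K (w * b) = 0} \ {g.fst * θ g.fst - g.snd} := by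
      ext b
      have h3 : g.snd + b + -(g.fst * θ g.fst) = 0 ↔ b = g.fst * θ g.fst - g.snd := by
        constructor <;> intro h <;> linear_combination h
      simp only [mem_D'_iff, mem_D_iff hθ, fst_mul, snd_mul, Set.mem_ofPred_eq, Set.mem_sdiff,
        Set.mem_singleton_iff, map_neg, mul_neg, neg_mul, neg_neg, neg_eq_zero, hg, ← hw,
        add_neg_cancel, ne_eq, h3]
      simp
    have h2 : g ∈ D θ z ↔
        g.fst * θ g.fst - g.snd ∈ {b | Algebra.trace (ZMod p) K (w * b) = 0} := by
      have h3 : w * (g.fst * θ g.fst - g.snd) = z - w * g.snd := by rw [hw]; field_simp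
      rw [hgD, Set.mem_ofPred_eq, h3, map_sub, hztr, zero_sub, neg_eq_zero]
    rw [h1, if_congr h2 rfl rfl, ncard_sdiff_singleton_add, ncard_trace_mul_eq hm hK hw0]
  have hslice : ∀ a : K,
      {b | (⟨a, b⟩ : SuzukiGroup θ) ∈ {h | h ∈ D' θ z ∧ g * h ∈ D' θ z}}.ncard =
      {b | (⟨a, b⟩ : SuzukiGroup θ) ∈ {h | h ∈ D θ z ∧ g * h ∈ D θ z}}.ncard +
      ((if a = 0 then {b | (⟨0, b⟩ : SuzukiGroup θ) ∈
        {h | h ∈ D' θ z ∧ g * h ∈ D' θ z}}.ncard else 0) +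
      if a = -g.fst then {b | (⟨-g.fst, b⟩ : SuzukiGroup θ) ∈
        {h | h ∈ D' θ z ∧ g * h ∈ D' θ z}}.ncard else 0) := by
    intro a
    by_cases ha : a = 0
    · rw [slice_D_translate_eq_empty hθ z g (Or.inl ha), if_pos ha, ha, Set.ncard_empty, zero_add,
        if_neg (neg_ne_zero.2 hg).symm, add_zero]
    · by_cases hga : a = -g.fst
      · rw [slice_D_translate_eq_empty hθ z g (Or.inr (by rw [hga, add_neg_cancel])), if_neg ha,
          if_pos hga, hga, Set.ncard_empty, zero_add, zero_add]
      · rw [slice_D'_translate z g ha (by rwa [Ne, add_comm, add_eq_zero_iff_eq_neg]), if_neg ha,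
          if_neg hga, add_zero, add_zero]
  rw [ncard_eq_sum, Finset.sum_congr rfl fun a _ => hslice a, Finset.sum_add_distrib,
    Finset.sum_add_distrib, ← ncard_eq_sum, Finset.sum_ite_eq', Finset.sum_ite_eq',
    if_pos (Finset.mem_univ _), if_pos (Finset.mem_univ _)]
  zify at hzero hneg
  push_cast
  linear_combination hzero + hneg

end SuzukiGroup

/-! ### The order of `θ` and the final parameters. -/

/-- The power `f = m / gcd(l, m)` of the automorphism `a ↦ a ^ p ^ l` is trivial. -/
theorem pow_div_gcd_eq_one {p : ℕ} [Fact p.Prime] {K : Type*} [Field K] [Finite K]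
    [Algebra (ZMod p) K] {m : ℕ} (hK : Nat.card K = p ^ m) {θ : K ≃ₐ[ZMod p] K} {l : ℕ}
    (hθ : ∀ a : K, θ a = a ^ p ^ l) : θ ^ (m / Nat.gcd l m) = 1 := by
  have := Fintype.ofFinite K
  have hpow : ∀ (k : ℕ) (a : K), (θ ^ k) a = a ^ p ^ (l * k) := by
    intro k a
    induction k with
    | zero => simp
    | succ k ih => rw [pow_succ', AlgEquiv.mul_apply, ih, hθ, ← pow_mul, ← pow_add, mul_add_one]
  ext a
  have hdiv : l * (m / Nat.gcd l m) = m * (l / Nat.gcd l m) := by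
    rw [← Nat.mul_div_assoc _ (Nat.gcd_dvd_right l m), ← Nat.mul_div_assoc _ (Nat.gcd_dvd_left l m),
      mul_comm]
  rw [hpow, hdiv, pow_mul, ← hK, Nat.card_eq_fintype_card, FiniteField.pow_card_pow]
  rfl

theorem mainTheorem7 {p : ℕ} [Fact p.Prime] (hp : p ≠ 2)
    {K : Type*} [Field K] [Finite K] [Algebra (ZMod p) K]
    (m : ℕ) (hK : Nat.card K = p ^ m)
    (θ : K ≃ₐ[ZMod p] K) (l : ℕ) (hl : 0 < l) (hθ : ∀ a : K, θ a = a ^ p ^ l)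
    (e f : ℕ) (he : e = Nat.gcd l m) (hf : f = m / e)
    (hm_odd : Odd m) (hf_gt : 1 < f) (hf_odd : Odd f) (hpf : ¬ p ∣ f)
    (z : SuzukiGroup.fixedField θ) (hz : z ≠ 0) (hz_sq : IsSquare z)
    (hz_tr : Algebra.trace (ZMod p) (SuzukiGroup.fixedField θ) z = 0) :
    IsLatinSquareCentralPDS (SuzukiGroup.D θ z)
      ((p : ℤ) ^ (2 * m))
      ((p : ℤ) ^ (m - 1) * ((p : ℤ) ^ m - 1))
      ((p : ℤ) ^ (2 * (m - 1)) + (p : ℤ) ^ m - 3 * (p : ℤ) ^ (m - 1))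
      ((p : ℤ) ^ (2 * (m - 1)) - (p : ℤ) ^ (m - 1)) ∧
    IsLatinSquareCentralPDS (SuzukiGroup.D' θ z)
      ((p : ℤ) ^ (2 * m))
      (((p : ℤ) ^ (m - 1) + 1) * ((p : ℤ) ^ m - 1))
      ((p : ℤ) ^ (2 * (m - 1)) + (p : ℤ) ^ m - (p : ℤ) ^ (m - 1) - 2)
      ((p : ℤ) ^ (2 * (m - 1)) + (p : ℤ) ^ (m - 1)) := by
  have hθf : θ ^ f = 1 := by rw [hf, he]; exact pow_div_gcd_eq_one hK hθ
  -- It is enough that the order divides `f`; its exact value plays no role.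
  have hord : ¬ p ∣ orderOf θ := fun h => hpf (h.trans (orderOf_dvd_of_pow_eq_one hθf))
  have hθ2 : ∀ t, θ (θ t) = t → θ t = t := fun t =>
    apply_eq_self_of_apply_apply_eq_self hf_odd hθf
  have hm2 : 2 ≤ m := hf_gt.trans_le (hf ▸ Nat.div_le_self m e)
  have hm1 : 1 ≤ m := by omega
  have hztr : Algebra.trace (ZMod p) K (z : K) = 0 :=
    (SuzukiGroup.trace_coe_eq_zero_iff hord z).2 hz_tr
  have hv : (Nat.card (SuzukiGroup θ) : ℤ) = (p : ℤ) ^ (2 * m) := by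
    rw [SuzukiGroup.natCard_eq hK]; push_cast; rfl
  have hsnd : ∀ g : SuzukiGroup θ, g ≠ 1 → g.fst = 0 → g.snd ≠ 0 := fun g hg h0 h =>
    hg (SuzukiGroup.ext h0 h)
  have hpm : (p : ℤ) ^ m = p * p ^ (m - 1) := by
    rw [← pow_succ', Nat.sub_add_cancel hm1]
  refine ⟨⟨IsPDS.of_ncard_translate hv (SuzukiGroup.ncard_D hord hm1 hK hz) ?_ ?_,
    SuzukiGroup.isRegularSubset_D hord hztr, SuzukiGroup.isCentralSubset_D hord z,
    p ^ m, p ^ (m - 1), ?_⟩,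
    ⟨IsPDS.of_ncard_translate hv (SuzukiGroup.ncard_D' hord hm1 hK hz) ?_ ?_,
    SuzukiGroup.isRegularSubset_D' hord hztr, SuzukiGroup.isCentralSubset_D' hord z,
    p ^ m, p ^ (m - 1) + 1, ?_⟩⟩
  · intro g _ hgD
    rw [SuzukiGroup.ncard_translate_D_of_fst_ne_zero hp hord hθ2 hm2 hm_odd hK hz hztr
      ((SuzukiGroup.mem_D_iff hord).1 hgD).1, if_pos hgD, hpm]
    ring
  · intro g hg hgD
    by_cases h0 : g.fst = 0
    · exact SuzukiGroup.ncard_translate_D_of_fst_eq_zero hp hord hθ2 hm_odd hK hz h0 (hsnd g hg h0)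
    · rw [SuzukiGroup.ncard_translate_D_of_fst_ne_zero hp hord hθ2 hm2 hm_odd hK hz hztr h0,
        if_neg hgD, add_zero]
  · push_cast
    refine ⟨?_, ?_, ?_, ?_⟩ <;> ring
  · intro g hg hgD
    by_cases h0 : g.fst = 0
    · rw [SuzukiGroup.ncard_translate_D'_of_fst_eq_zero hord hK z h0 (hsnd g hg h0),
        SuzukiGroup.ncard_translate_D_of_fst_eq_zero hp hord hθ2 hm_odd hK hz h0 (hsnd g hg h0)]
      ring
    · have hgD' : g ∈ SuzukiGroup.D θ z :=
        (SuzukiGroup.mem_D'_iff.1 hgD).resolve_left fun h => h0 h.1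
      rw [SuzukiGroup.ncard_translate_D'_of_fst_ne_zero hord hm1 hK hz hztr h0,
        SuzukiGroup.ncard_translate_D_of_fst_ne_zero hp hord hθ2 hm2 hm_odd hK hz hztr h0,
        if_pos hgD', if_pos hgD', hpm]
      ring
  · intro g hg hgD
    rw [SuzukiGroup.mem_D'_iff, not_or] at hgD
    have h0 : g.fst ≠ 0 := fun h0 => hgD.1 ⟨h0, hsnd g hg h0⟩
    rw [SuzukiGroup.ncard_translate_D'_of_fst_ne_zero hord hm1 hK hz hztr h0,
      SuzukiGroup.ncard_translate_D_of_fst_ne_zero hp hord hθ2 hm2 hm_odd hK hz hztr h0,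
      if_neg hgD.2, if_neg hgD.2]
    ring
  · push_cast
    refine ⟨?_, ?_, ?_, ?_⟩ <;> ring
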